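/- There is one divisible good of total amount $1$ and $n$ players. Player $i$ has a publicly known initial endowment $r_i\ge 0$, with $\sum_i r_i=1$, and a private valuation $v_i:[0,1]\to\mathbb R$ that is normalized ($v_i(0)=0$), non-decreasing, and has decreasing marginal values: $v_i(y+\varepsilon)-v_i(y)\le v_i(x+\varepsilon)-v_i(x)$ whenever $\varepsilon>0$, $0\le x<y$ and $y+\varepsilon\le 1$ (that is, $v_i$ is concave). An allocation is a vector $a\in[0,1]^n$ with $\sum_i a_i=1$; its welfare is $\sum_i v_i(a_i)$, and $OPT(v)$ is the supremum of the welfare over all allocations. A (deterministic, direct-revelation) mechanism maps each profile of reported valuations $v=(v_1,\dots,v_n)$ to an allocation $A(v)$ and payments $p(v)\in\mathbb R^n$ (negative payments are made to the player). A randomized mechanism is a probability distribution, independent of the reports, over deterministic mechanisms $(A^\omega,p^\omega)$. **Theorem 5.1 (Arrow–Debreu markets).** Suppose that $r_i\le \frac13$ for every $i$. Then there is a randomized mechanism, not depending on any information about the valuations other than the reports, such that: 1. (truthfulness) for every realization $\omega$, every profile $v$, every player $i$ and every valuation $w$, with $v^{(w)}$ denoting $v$ with $v_i$ replaced by $w$,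 $$v_i(A^\omega_i(v))-p^\omega_i(v)\ \ge\ v_i(A^\omega_i(v^{(w)}))-p^\omega_i(v^{(w)});$$ 2. (individual rationality) $v_i(A^\omega_i(v))-p^\omega_i(v)\ge v_i(r_i)$ for every $\omega$, $v$ and $i$; 3. (weak budget balance) $\sum_i p^\omega_i(v)\ge 0$ for every $\omega$ and $v$; 4. ($48$-approximation) $\mathbb E_\omega\big[\sum_i v_i(A^\omega_i(v))\big]\ \ge\ \frac{OPT(v)}{48}$ for every profile $v$. -/

import Mathlib

open MeasureTheory

noncomputable section

namespace ArrowDebreu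

/-- A valuation for amounts in `[0,1]` of one divisible good: normalized, non-decreasing and with
decreasing marginal values (no continuity is assumed, so a jump at `0` is allowed). -/
structure Valuation where
  /-- the value of each amount of the good -/
  toFun : unitInterval → ℝ
  normalized : toFun 0 = 0
  monotone : Monotone toFun
  decreasing_marginals : ∀ (ε : ℝ) (x y : unitInterval)
    (hx : (x : ℝ) + ε ∈ unitInterval) (hy : (y : ℝ) + ε ∈ unitInterval), 0 < ε → x < y →
      toFun ⟨(y : ℝ) + ε, hy⟩ - toFun y ≤ toFun ⟨(x : ℝ) + ε, hx⟩ - toFun x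

instance : CoeFun Valuation (fun _ => unitInterval → ℝ) := ⟨Valuation.toFun⟩

/-- A division of the whole unit of the good among `n` players. -/
def Allocation (n : ℕ) : Type :=
  {a : Fin n → unitInterval // ∑ i, (a i : ℝ) = 1}

/-- The social welfare of an allocation. -/
def welfare {n : ℕ} (v : Fin n → Valuation) (a : Allocation n) : ℝ :=
  ∑ i, v i (a.1 i)

/-- The optimal welfare: the supremum of the welfare over all allocations. -/
def optWelfare {n : ℕ} (v : Fin n → Valuation) : ℝ :=
  ⨆ a : Allocation n, welfare v a

/-- A deterministic direct-revelation mechanism. A positive payment goes from the player to the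
mechanism, a negative one from the mechanism to the player. -/
structure Mechanism (n : ℕ) where
  /-- the allocation chosen for the reported valuations -/
  alloc : (Fin n → Valuation) → Allocation n
  /-- the payments of the players for the reported valuations -/
  pay : (Fin n → Valuation) → Fin n → ℝ

namespace Mechanism

variable {n : ℕ}

/-- Quasi-linear utility of player `i`, whose true valuation is `u`, when the valuations `b` are
reported. -/
def utility (M : Mechanism n) (i : Fin n) (u : Valuation) (b : Fin n → Valuation) : ℝ :=
  u ((M.alloc b).1 i) - M.pay b i

/-- Reporting the true valuation `v i` is a dominant strategy: whatever the others report,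
no report `w` gives player `i` more utility. -/
def Truthful (M : Mechanism n) : Prop :=
  ∀ (v : Fin n → Valuation) (i : Fin n) (w : Valuation),
    M.utility i (v i) (Function.update v i w) ≤ M.utility i (v i) v

/-- No truthful player is worse off than with her initial endowment `r i`. -/
def IndividuallyRational (M : Mechanism n) (r : Allocation n) : Prop :=
  ∀ (v : Fin n → Valuation) (i : Fin n), v i (r.1 i) ≤ M.utility i (v i) v

/-- The mechanism never subsidizes the players. -/
def WeaklyBudgetBalanced (M : Mechanism n) : Prop :=
  ∀ v : Fin n → Valuation, 0 ≤ ∑ i, M.pay v i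

end Mechanism

/-- A randomized mechanism: a deterministic mechanism drawn from a probability distribution that
does not depend on the reports. (Valuations are monotone and bounded, so measurability of the
allocation makes the welfare an integrable random variable.) -/
structure RandomizedMechanism (n : ℕ) where
  /-- the random coins of the mechanism -/
  Coins : Type
  [measurableSpace : MeasurableSpace Coins]
  /-- the law of the coins -/
  law : Measure Coins
  [isProbabilityMeasure : IsProbabilityMeasure law]
  /-- the deterministic mechanism that is run for given coins -/
  run : Coins → Mechanism n
  measurable_alloc : ∀ (v : Fin n → Valuation) (i : Fin n),
    Measurable fun ω => ((run ω).alloc v).1 i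
  measurable_pay : ∀ (v : Fin n → Valuation) (i : Fin n),
    Measurable fun ω => (run ω).pay v i

namespace RandomizedMechanism

variable {n : ℕ}

/-- Ex-post truthfulness: truth-telling is dominant for every realization of the coins. -/
def Truthful (M : RandomizedMechanism n) : Prop :=
  ∀ ω, (M.run ω).Truthful

/-- Ex-post individual rationality with respect to the endowments `r`. -/
def IndividuallyRational (M : RandomizedMechanism n) (r : Allocation n) : Prop :=
  ∀ ω, (M.run ω).IndividuallyRational r

/-- Ex-post weak budget balance. -/
def WeaklyBudgetBalanced (M : RandomizedMechanism n) : Prop :=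
  ∀ ω, (M.run ω).WeaklyBudgetBalanced

/-- The expected welfare, over the coins, when the valuations `v` are reported truthfully. -/
def expectedWelfare (M : RandomizedMechanism n) (v : Fin n → Valuation) : ℝ :=
  letI := M.measurableSpace
  ∫ ω, welfare v ((M.run ω).alloc v) ∂M.law

/-- In every instance the expected welfare is at least a `1/α` fraction of the optimal welfare. -/
def Approximates (M : RandomizedMechanism n) (α : ℝ) : Prop :=
  ∀ v : Fin n → Valuation, optWelfare v / α ≤ M.expectedWelfare v

end RandomizedMechanism

end ArrowDebreu

end

/-!
The market is cut into `100 * n` small units. Only whole units are traded, so every player chooses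
from a finite menu and has a best choice even if her valuation jumps at `0`. A fair coin puts each
player on one of two sides. From the reports on one side a price is computed: the lowest one at
which that side wants at most `N = 14 * n` units, ties being broken by the names of the players.
The *other* side trades at this price: each player asks for the number of units that is best for
her at the price, and buyers as well as sellers are served one after the other until one of the two
groups is exhausted. A player affects neither her price nor the room left for her by the others, and
by concavity her utility is single-peaked in the number of units, so that truth-telling is dominant
and nobody loses (`le_holding_of_singlePeaked`). Within each side the payments cancel.

For the welfare, let `o` be an optimal division of `N` units. It has at least an eighth of the
optimal welfare by concavity (`exists_units_welfare`), and with the right choice among the optimal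
divisions each player `i` wants at least `o i` units at the price of any sample that does not
contain her (`exists_optimal_units`). Fix a partition of the players other than `i` into two groups
`A` and `T`. If the price of `A` is at most that of `T`, then `A` wants at most `N` units at the
price of `T`, hence player `i`, when she is on the side of `A`, gets all she wants or all but `N` of
the units of her side (`min_le_holding`). Otherwise the same holds with `A` and `T` exchanged. So
one of the two sides that `i` may join is good for her, and she has a fair chance to join it
(`credit_mul_le_add_flipOthers`). What she gets there is bounded below in terms of the imbalance of
the endowments between `A` and `T`, whose second moment is small since no endowment exceeds `1 / 3`
(`sum_imbalance_sq`, `sum_othersUnits_sq_le`). Numerically, player `i` gets on average at least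
`1 / 2 * (1 - 2 / 3) = 1 / 6` of the value of `o i` units (`sixth_le_average`), and `6 * 8 = 48`.
-/

noncomputable section

namespace ArrowDebreu

open Finset

/-! ### Trading at a posted price with sequential rationing -/

section Rationing

variable {ι : Type*} [LinearOrder ι]

/-- The number of units that trader `i` of the group `G` can still obtain when each trader `j`
holds `e j` units and wants to hold `d j`: what the others offer, minus what the traders before
`i` want. With `d` and `e` exchanged, it is the number of units that `i` can still get rid of.
Subtraction of natural numbers is truncated. -/
def capacity (d e : ι → ℕ) (G : Finset ι) (i : ι) : ℕ :=
  (∑ j ∈ G.erase i, (e j - d j)) - ∑ j ∈ G with j < i, (d j - e j)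

/-- The number of units bought by `i`. With `d` and `e` exchanged: the number of units sold. -/
def bought (d e : ι → ℕ) (G : Finset ι) (i : ι) : ℕ :=
  min (d i - e i) (capacity d e G i)

/-- The number of units held by `i` after trade. -/
def holding (d e : ι → ℕ) (G : Finset ι) (i : ι) : ℕ :=
  e i + bought d e G i - bought e d G i

/-- The capacity of a trader does not depend on her own demand. -/
theorem capacity_congr {d d' e e' : ι → ℕ} {G : Finset ι} {i : ι}
    (h : ∀ j ∈ G, j ≠ i → d j = d' j) (h' : ∀ j ∈ G, j ≠ i → e j = e' j) :
    capacity d e G i = capacity d' e' G i := by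
  unfold capacity
  congr 1
  · refine sum_congr rfl fun j hj => ?_
    rw [h j (mem_of_mem_erase hj) (ne_of_mem_erase hj),
      h' j (mem_of_mem_erase hj) (ne_of_mem_erase hj)]
  · refine sum_congr rfl fun j hj => ?_
    rw [mem_filter] at hj
    rw [h j hj.1 hj.2.ne, h' j hj.1 hj.2.ne]

theorem bought_swap_le (d e : ι → ℕ) (G : Finset ι) (i : ι) : bought e d G i ≤ e i := by
  unfold bought
  omega

/-- Serving the requests `z` one after the other from a supply `S` hands out the whole supply or
satisfies all requests. -/
theorem sum_min_sub_prefix (z : ι → ℕ) (S : ℕ) (s : Finset ι) :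
    ∑ i ∈ s, min (z i) (S - ∑ j ∈ s with j < i, z j) = min S (∑ j ∈ s, z j) := by
  induction s using Finset.induction_on_max with
  | empty => simp
  | insert a s ha ih =>
    have hna : a ∉ s := fun h => lt_irrefl _ (ha a h)
    rw [sum_insert hna, sum_insert hna]
    have h1 : ({j ∈ insert a s | j < a} : Finset ι) = s := by
      ext j
      simp only [mem_filter, mem_insert]
      constructor
      · rintro ⟨rfl | h, h'⟩
        · exact absurd h' (lt_irrefl _)
        · exact h
      · exact fun h => ⟨Or.inr h, ha j h⟩
    have h2 : ∀ i ∈ s, ({j ∈ insert a s | j < i} : Finset ι) = {j ∈ s | j < i} := by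
      intro i hi
      rw [filter_insert, if_neg (ha i hi).not_gt]
    have h3 : ∑ i ∈ s, min (z i) (S - ∑ j ∈ insert a s with j < i, z j)
        = ∑ i ∈ s, min (z i) (S - ∑ j ∈ s with j < i, z j) :=
      sum_congr rfl fun i hi => by rw [h2 i hi]
    rw [h1, h3, ih]
    omega

theorem sum_bought (d e : ι → ℕ) (G : Finset ι) :
    ∑ i ∈ G, bought d e G i = min (∑ j ∈ G, (e j - d j)) (∑ j ∈ G, (d j - e j)) := by
  rw [← sum_min_sub_prefix]
  refine sum_congr rfl fun i hi => ?_
  unfold bought capacity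
  -- A trader who wants to buy offers nothing, so her own offer may be left out of the supply.
  have := sum_erase_add G (fun j => e j - d j) hi
  rw [← this]
  omega

theorem sum_holding (d e : ι → ℕ) (G : Finset ι) :
    ∑ i ∈ G, holding d e G i = ∑ i ∈ G, e i := by
  have h : ∀ i ∈ G, holding d e G i + bought e d G i = e i + bought d e G i := by
    intro i _
    have := bought_swap_le d e G i
    unfold holding
    omega
  have h1 := sum_congr rfl h
  rw [sum_add_distrib, sum_add_distrib, sum_bought, sum_bought, min_comm] at h1
  omega

theorem holding_le {d e : ι → ℕ} {G : Finset ι} {i : ι} {E : ℕ} (hd : d i ≤ E) (he : e i ≤ E) :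
    holding d e G i ≤ E := by
  unfold holding bought
  omega

/-- A trader with a single-peaked utility function, whose peak is `d i`, does not gain by
reporting another peak: both outcomes lie in the range cut out by her capacities, and
truth-telling yields the point of that range which is closest to the peak. -/
theorem le_holding_of_singlePeaked {U : ℕ → ℝ} {d d' e : ι → ℕ} {G : Finset ι} {i : ι} {E : ℕ}
    (hinc : ∀ k < d i, U k ≤ U (k + 1)) (hdec : ∀ k, d i ≤ k → k < E → U (k + 1) ≤ U k)
    (hother : ∀ j ∈ G, j ≠ i → d' j = d j) (he : e i ≤ E) (hd' : d' i ≤ E) (hd : d i ≤ E) :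
    U (holding d' e G i) ≤ U (holding d e G i) := by
  have hmono : ∀ a b, a ≤ b → b ≤ d i → U a ≤ U b := by
    intro a b hab
    induction b, hab using Nat.le_induction with
    | base => exact fun _ => le_rfl
    | succ b _ ih => exact fun hb => (ih (by omega)).trans (hinc b (by omega))
  have hanti : ∀ a b, a ≤ b → d i ≤ a → b ≤ E → U b ≤ U a := by
    intro a b hab hda
    induction b, hab using Nat.le_induction with
    | base => exact fun _ => le_rfl
    | succ b _ ih => exact fun hb => (hdec b (by omega) (by omega)).trans (ih (by omega))
  have hE := holding_le (G := G) hd he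
  have hE' := holding_le (G := G) hd' he
  have hA := capacity_congr (e := e) (e' := e) hother fun _ _ _ => rfl
  have hB := capacity_congr (d := e) (d' := e) (fun _ _ _ => rfl) hother
  unfold holding bought at hE hE' ⊢
  rw [hA, hB] at hE' ⊢
  set A := capacity d e G i
  set B := capacity e d G i
  rcases lt_trichotomy (e i + min (d i - e i) A - min (e i - d i) B) (d i) with h | h | h
  · exact hmono _ _ (by omega) h.le
  · rw [h]
    rcases le_total (e i + min (d' i - e i) A - min (e i - d' i) B) (d i) with h' | h'
    · exact hmono _ _ h' le_rfl
    · exact hanti _ _ h' le_rfl hE'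
  · exact hanti _ _ (by omega) h.le hE'

/-- Nobody loses by trading. -/
theorem le_holding_of_singlePeaked_self {U : ℕ → ℝ} {d e : ι → ℕ} {G : Finset ι} {i : ι} {E : ℕ}
    (hinc : ∀ k < d i, U k ≤ U (k + 1)) (hdec : ∀ k, d i ≤ k → k < E → U (k + 1) ≤ U k)
    (he : e i ≤ E) (hd : d i ≤ E) : U (e i) ≤ U (holding d e G i) := by
  have h := le_holding_of_singlePeaked (d' := Function.update d i (e i)) (G := G) hinc hdec
    (fun j _ hj => Function.update_of_ne hj _ _) he (by simpa using he) hd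
  have h' : holding (Function.update d i (e i)) e G i = e i := by
    simp [holding, bought]
  rwa [h'] at h

/-- If the other traders want at most `N` units in total, then trader `i` is rationed only when
she already holds all but `N` of the units of the group. -/
theorem min_le_holding {d e : ι → ℕ} {G : Finset ι} {i : ι} {N : ℕ} (hi : i ∈ G)
    (h : ∑ j ∈ G.erase i, d j ≤ N) : min (d i) (∑ j ∈ G, e j - N) ≤ holding d e G i := by
  have h1 : ∑ j ∈ G.erase i, (e j - d j) + ∑ j ∈ G.erase i, d j
      = ∑ j ∈ G.erase i, (d j - e j) + ∑ j ∈ G.erase i, e j := by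
    rw [← sum_add_distrib, ← sum_add_distrib]
    exact sum_congr rfl fun j _ => by omega
  have h2 : ∑ j ∈ G with j < i, (d j - e j) ≤ ∑ j ∈ G.erase i, (d j - e j) := by
    refine sum_le_sum_of_subset fun j hj => ?_
    rw [mem_filter] at hj
    exact mem_erase.2 ⟨hj.2.ne, hj.1⟩
  have h3 := sum_erase_add G e hi
  unfold holding bought capacity
  omega

end Rationing

/-! ### Demand and the price computed from a sample -/

section Price

variable {n : ℕ}

/-- The key of a unit of marginal value `x` for player `i`. Keys are ordered lexicographically, so
that units of equal value for different players are told apart by the names of the players. -/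
def key (x : ℝ) (i : Fin n) : WithBot (ℝ ×ₗ Fin n) := (toLex (x, i) : ℝ ×ₗ Fin n)

/-- The number of units, out of `E`, that player `i` with marginal values `f` wants at the
price `π`. -/
def demand (E : ℕ) (f : ℕ → ℝ) (i : Fin n) (π : WithBot (ℝ ×ₗ Fin n)) : ℕ :=
  #{k ∈ range E | π < key (f k) i}

/-- The number of units that the players in `T` with marginal values `m` want at the price `π`. -/
def totalDemand (E : ℕ) (m : Fin n → ℕ → ℝ) (T : Finset (Fin n)) (π : WithBot (ℝ ×ₗ Fin n)) : ℕ :=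
  ∑ j ∈ T, demand E (m j) j π

/-- The possible prices for the sample `T`: the keys of the units of `T`, and the bottom element,
at which everything is wanted. -/
def candidates (E : ℕ) (m : Fin n → ℕ → ℝ) (T : Finset (Fin n)) :
    Finset (WithBot (ℝ ×ₗ Fin n)) :=
  insert ⊥ ((T ×ˢ range E).image fun x => key (m x.1 x.2) x.1)

theorem key_lt_key {x y : ℝ} {i j : Fin n} : key x i < key y j ↔ x < y ∨ x = y ∧ i < j := by
  simp [key, WithBot.coe_lt_coe, Prod.Lex.toLex_lt_toLex]

theorem key_mono {x y : ℝ} (h : x ≤ y) (i : Fin n) : key x i ≤ key y i := by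
  rw [key, key, WithBot.coe_le_coe, Prod.Lex.toLex_le_toLex]
  rcases h.lt_or_eq with h | h
  · exact Or.inl h
  · exact Or.inr ⟨h, le_rfl⟩

theorem demand_le (E : ℕ) (f : ℕ → ℝ) (i : Fin n) (π) : demand E f i π ≤ E :=
  (card_filter_le _ _).trans (card_range E).le

theorem demand_antitone (E : ℕ) (f : ℕ → ℝ) (i : Fin n) : Antitone (demand E f i) := by
  intro π π' h
  exact card_le_card fun k hk => by
    rw [mem_filter] at hk ⊢
    exact ⟨hk.1, h.trans_lt hk.2⟩

theorem totalDemand_antitone (E : ℕ) (m : Fin n → ℕ → ℝ) (T : Finset (Fin n)) :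
    Antitone (totalDemand E m T) :=
  fun _ _ h => sum_le_sum fun j _ => demand_antitone E (m j) j h

/-- With decreasing marginal values, the units that are wanted are the first ones. -/
theorem lt_demand_iff {E : ℕ} {f : ℕ → ℝ} (hf : AntitoneOn f (Set.Iio E)) {i : Fin n}
    {π : WithBot (ℝ ×ₗ Fin n)} {k : ℕ} (hk : k < E) :
    k < demand E f i π ↔ π < key (f k) i := by
  constructor
  · intro h
    by_contra hc
    have hsub : ({l ∈ range E | π < key (f l) i} : Finset ℕ) ⊆ range k := by
      intro l hl
      rw [mem_filter, mem_range] at hl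
      rw [mem_range]
      by_contra hlk
      exact hc (hl.2.trans_le (key_mono (hf hk hl.1 (not_lt.1 hlk)) i))
    have := card_le_card hsub
    rw [card_range] at this
    exact absurd h this.not_gt
  · intro h
    have hsub : range (k + 1) ⊆ ({l ∈ range E | π < key (f l) i} : Finset ℕ) := by
      intro l hl
      rw [mem_range] at hl
      rw [mem_filter, mem_range]
      exact ⟨by omega, h.trans_le (key_mono (hf (show l < E by omega) hk (by omega)) i)⟩
    have := card_le_card hsub
    rw [card_range] at this
    exact this

theorem key_mem_candidates {E : ℕ} (m : Fin n → ℕ → ℝ) {T : Finset (Fin n)} {j : Fin n} {k : ℕ}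
    (hj : j ∈ T) (hk : k ∈ range E) : key (m j k) j ∈ candidates E m T := by
  unfold candidates
  rw [mem_insert, mem_image]
  exact Or.inr ⟨(j, k), mem_product.2 ⟨hj, hk⟩, rfl⟩

theorem exists_candidate (E N : ℕ) (m : Fin n → ℕ → ℝ) (T : Finset (Fin n)) :
    ({π ∈ candidates E m T | totalDemand E m T π ≤ N}).Nonempty := by
  have hne : (candidates E m T).Nonempty := insert_nonempty _ _
  refine ⟨(candidates E m T).max' hne, mem_filter.2 ⟨max'_mem _ _, ?_⟩⟩
  have : totalDemand E m T ((candidates E m T).max' hne) = 0 := by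
    refine sum_eq_zero fun j hj => card_eq_zero.2 (filter_eq_empty_iff.2 fun k hk => ?_)
    exact not_lt.2 (le_max' _ _ (key_mem_candidates m hj hk))
  omega

/-- The price computed from the sample `T`: the lowest one at which `T` wants at most `N` units. -/
def price (E N : ℕ) (m : Fin n → ℕ → ℝ) (T : Finset (Fin n)) : WithBot (ℝ ×ₗ Fin n) :=
  ({π ∈ candidates E m T | totalDemand E m T π ≤ N}).min' (exists_candidate E N m T)

/-- The amount of money to be paid for one unit; the bottom price stands for `0`. -/
def rate (π : WithBot (ℝ ×ₗ Fin n)) : ℝ :=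
  WithBot.recBotCoe 0 (fun x => (ofLex x).1) π

theorem rate_le_of_lt_key {π : WithBot (ℝ ×ₗ Fin n)} {x : ℝ} {i : Fin n} (hx : 0 ≤ x)
    (h : π < key x i) : rate π ≤ x := by
  induction π using WithBot.recBotCoe with
  | bot => exact hx
  | coe π =>
    obtain ⟨y, j⟩ := π
    rcases key_lt_key.1 (show key y j < key x i from h) with h | h
    · exact h.le
    · exact h.1.le

theorem le_rate_of_key_le {π : WithBot (ℝ ×ₗ Fin n)} {x : ℝ} {i : Fin n}
    (h : ¬ π < key x i) : x ≤ rate π := by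
  induction π using WithBot.recBotCoe with
  | bot => exact absurd (WithBot.bot_lt_coe _) h
  | coe π =>
    obtain ⟨y, j⟩ := π
    by_contra hc
    exact h (show key y j < key x i from key_lt_key.2 (Or.inl (not_le.1 hc)))

theorem totalDemand_price_le (E N : ℕ) (m : Fin n → ℕ → ℝ) (T : Finset (Fin n)) :
    totalDemand E m T (price E N m T) ≤ N :=
  (mem_filter.1 (min'_mem _ (exists_candidate E N m T))).2

theorem price_congr {E N : ℕ} {m m' : Fin n → ℕ → ℝ} {T : Finset (Fin n)}
    (h : ∀ j ∈ T, m j = m' j) : price E N m T = price E N m' T := by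
  have hc : candidates E m T = candidates E m' T := by
    unfold candidates
    congr 1
    refine image_congr fun x hx => ?_
    simp only [h x.1 (mem_product.1 hx).1]
  have hd : totalDemand E m T = totalDemand E m' T := by
    funext π
    exact sum_congr rfl fun j hj => by rw [h j hj]
  unfold price
  congr 1
  rw [hc, hd]

/-- A unit of a player outside the sample beats the price of the sample if and only if at most
`N` units of the sample beat that unit. -/
theorem price_lt_key_iff {E N : ℕ} {m : Fin n → ℕ → ℝ} {T : Finset (Fin n)} {i : Fin n}
    (hi : i ∉ T) {x : ℝ} : price E N m T < key x i ↔ totalDemand E m T (key x i) ≤ N := by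
  refine ⟨fun h => (totalDemand_antitone E m T h.le).trans (totalDemand_price_le E N m T),
    fun h => ?_⟩
  have hne : ({π ∈ candidates E m T | π < key x i}).Nonempty :=
    ⟨⊥, mem_filter.2 ⟨mem_insert_self _ _, WithBot.bot_lt_coe _⟩⟩
  -- No unit of the sample lies between the largest candidate below the given key and that key.
  obtain ⟨π, hπ, hmax⟩ := exists_max_image _ id hne
  rw [mem_filter] at hπ
  have hle : totalDemand E m T π ≤ totalDemand E m T (key x i) := by
    refine sum_le_sum fun j hj => card_le_card fun k hk => ?_
    rw [mem_filter] at hk ⊢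
    refine ⟨hk.1, ?_⟩
    by_contra hc
    have hlt : key (m j k) j < key x i := by
      rw [key_lt_key] at hc ⊢
      have hij : i ≠ j := fun hij => hi (hij ▸ hj)
      rcases lt_trichotomy (m j k) x with h1 | h1 | h1
      · exact Or.inl h1
      · rcases lt_trichotomy i j with h2 | h2 | h2
        · exact absurd (Or.inr ⟨h1.symm, h2⟩) hc
        · exact absurd h2 hij
        · exact Or.inr ⟨h1, h2⟩
      · exact absurd (Or.inl h1) hc
    exact absurd hk.2 (not_lt.2 (hmax _ (mem_filter.2 ⟨key_mem_candidates m hj hk.1, hlt⟩)))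
  exact (min'_le _ _ (mem_filter.2 ⟨hπ.1, hle.trans h⟩)).trans_lt hπ.2

end Price

/-! ### An optimal division of few units -/

section Optimum

variable {n : ℕ}

theorem sum_update_move {g : Fin n → ℕ → ℝ} {o : Fin n → ℕ} {i j : Fin n} (hij : i ≠ j)
    (a c : ℕ) :
    ∑ l, g l (Function.update (Function.update o i a) j c l)
      = ∑ l, g l (o l) + (g i a - g i (o i)) + (g j c - g j (o j)) := by
  have h : ∀ l, g l (Function.update (Function.update o i a) j c l)
      = g l (o l) + (if l = i then g i a - g i (o i) else 0)
        + (if l = j then g j c - g j (o j) else 0) := by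
    intro l
    by_cases hj : l = j
    · subst hj
      simp [Ne.symm hij]
    · by_cases hi : l = i
      · subst hi
        simp [hij]
      · simp [hi, hj]
  simp [h, sum_add_distrib]

/-- Among the divisions of `N` units with the largest value, the one that favours players with
large names gives no player more than she demands at the price of any sample that does not
contain her: otherwise more than `N` units of the sample would beat her last unit, one of them
would be unassigned, and moving a unit to its owner would improve the division. -/
theorem exists_optimal_units (E N : ℕ) (V : Fin n → ℕ → ℝ)
    (hV : ∀ i, AntitoneOn (fun k => V i (k + 1) - V i k) (Set.Iio E)) :
    ∃ o : Fin n → ℕ, ∑ i, o i ≤ N ∧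
      (∀ k : Fin n → ℕ, (∀ i, k i ≤ E) → ∑ i, k i ≤ N → ∑ i, V i (k i) ≤ ∑ i, V i (o i)) ∧
      ∀ (i : Fin n) (T : Finset (Fin n)), i ∉ T →
        o i ≤ demand E (fun k => V i (k + 1) - V i k) i
          (price E N (fun j k => V j (k + 1) - V j k) T) := by
  set m : Fin n → ℕ → ℝ := fun j k => V j (k + 1) - V j k with hm
  set F : Finset (Fin n → ℕ) :=
    {k ∈ Fintype.piFinset fun _ => range (E + 1) | ∑ i, k i ≤ N} with hF
  have memF : ∀ k, k ∈ F ↔ (∀ i, k i ≤ E) ∧ ∑ i, k i ≤ N := by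
    intro k
    simp [hF]
  have hne : F.Nonempty := ⟨fun _ => 0, by simp [memF]⟩
  obtain ⟨o, ho, hmax⟩ := F.exists_max_image
    (fun k => toLex (∑ i, V i (k i), ∑ i : Fin n, ((i : ℕ) : ℝ) * (k i : ℝ))) hne
  rw [memF] at ho
  refine ⟨o, ho.2, fun k hkE hkN => ?_, fun i T hi => ?_⟩
  · have := hmax k ((memF k).2 ⟨hkE, hkN⟩)
    rw [Prod.Lex.toLex_le_toLex] at this
    rcases this with h | h
    · exact h.le
    · exact h.1.le
  · by_contra hc
    replace hc : demand E (m i) i (price E N m T) < o i := not_le.1 hc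
    have hpos : 0 < o i := by omega
    have hlt : o i - 1 < E := by have := ho.1 i; omega
    have h1 : ¬ o i - 1 < demand E (m i) i (price E N m T) := by omega
    rw [lt_demand_iff (hV i) hlt, price_lt_key_iff hi, not_le] at h1
    have h2 : ∑ j ∈ T, o j < totalDemand E m T (key (m i (o i - 1)) i) :=
      ((sum_le_sum_of_subset (subset_univ T)).trans ho.2).trans_lt h1
    obtain ⟨j, hjT, hj⟩ := exists_lt_of_sum_lt h2
    have hjE : o j < E := hj.trans_le (demand_le _ _ _ _)
    rw [lt_demand_iff (hV j) hjE, key_lt_key] at hj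
    have hij : i ≠ j := fun h => hi (h ▸ hjT)
    set o' := Function.update (Function.update o i (o i - 1)) j (o j + 1) with ho'
    have hsum : ∑ l, ((o' l : ℕ) : ℝ) = ∑ l, (o l : ℝ) := by
      rw [ho', sum_update_move (g := fun _ k => (k : ℝ)) hij]
      push_cast [Nat.cast_sub hpos]
      ring
    have hmem : o' ∈ F := by
      refine (memF o').2 ⟨fun l => ?_, ?_⟩
      · rcases eq_or_ne l j with rfl | hl
        · simpa [ho'] using hjE
        · rcases eq_or_ne l i with rfl | hl'
          · simpa [ho', hl] using (Nat.sub_le _ _).trans (ho.1 l)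
          · simpa [ho', hl, hl'] using ho.1 l
      · have : (∑ l, o' l : ℕ) = ∑ l, o l := by exact_mod_cast hsum
        rw [this]
        exact ho.2
    refine absurd (hmax o' hmem) (not_le.2 ?_)
    rw [Prod.Lex.toLex_lt_toLex]
    have hval : ∑ l, V l (o' l) = ∑ l, V l (o l) - m i (o i - 1) + m j (o j) := by
      rw [ho', sum_update_move hij]
      simp only [hm, Nat.sub_add_cancel hpos]
      ring
    have hidx : ∑ l : Fin n, ((l : ℕ) : ℝ) * (o' l : ℝ)
        = ∑ l : Fin n, ((l : ℕ) : ℝ) * (o l : ℝ) - (i : ℕ) + (j : ℕ) := by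
      rw [ho', sum_update_move (g := fun l k => ((l : ℕ) : ℝ) * (k : ℝ)) hij]
      push_cast [Nat.cast_sub hpos]
      ring
    simp only [hval, hidx]
    rcases hj with h | h
    · left
      linarith
    · right
      have : ((i : ℕ) : ℝ) < ((j : ℕ) : ℝ) := by exact_mod_cast h.2
      exact ⟨by linarith [h.1], by linarith⟩

end Optimum

/-! ### Random sides -/

section RandomSides

variable {ι : Type*} [DecidableEq ι]

/-- Exchange the sides of all players but `i`. -/
def flipOthers (i : ι) (b : ι → Bool) : ι → Bool :=
  fun j => if j = i then b i else !b j

theorem flipOthers_involutive (i : ι) : Function.Involutive (flipOthers i : (ι → Bool) → ι → Bool) := by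
  intro b
  funext j
  by_cases h : j = i <;> simp [flipOthers, h]

variable [Fintype ι]

/-- The imbalance of the weights `a` between the two sides of a partition. -/
def imbalance (a : ι → ℝ) (b : ι → Bool) : ℝ :=
  ∑ j, (if b j then a j else -a j)

/-- The second moment of a sum with independent random signs. -/
theorem sum_imbalance_sq (a : ι → ℝ) :
    ∑ b : ι → Bool, imbalance a b ^ 2 = 2 ^ Fintype.card ι * ∑ j, a j ^ 2 := by
  have hoff : ∀ j l, j ≠ l →
      ∑ b : ι → Bool, (if b j then a j else -a j) * (if b l then a l else -a l) = 0 := by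
    intro j l hjl
    -- Flipping the side of `j` changes the sign of each summand.
    have hinv : Function.Involutive fun b : ι → Bool => Function.update b j (!b j) := by
      intro b
      simp
    have h := Equiv.sum_comp (hinv.toPerm _)
      fun b : ι → Bool => (if b j then a j else -a j) * (if b l then a l else -a l)
    have h' : ∀ b : ι → Bool,
        ((if hinv.toPerm _ b j then a j else -a j) * (if hinv.toPerm _ b l then a l else -a l))
          = -((if b j then a j else -a j) * (if b l then a l else -a l)) := by
      intro b
      simp only [Function.Involutive.coe_toPerm, Function.update_self,
        Function.update_of_ne hjl.symm]
      cases b j <;> cases b l <;> simp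
    simp only [h', sum_neg_distrib] at h
    linarith
  have hdiag : ∀ j, ∑ b : ι → Bool,
      (if b j then a j else -a j) * (if b j then a j else -a j)
        = 2 ^ Fintype.card ι * a j ^ 2 := by
    intro j
    have : ∀ b : ι → Bool, (if b j then a j else -a j) * (if b j then a j else -a j) = a j ^ 2 := by
      intro b
      split_ifs <;> ring
    simp [this, Fintype.card_pi]
  simp only [imbalance, sq, sum_mul_sum]
  rw [sum_comm, mul_sum]
  refine sum_congr rfl fun j _ => ?_
  rw [sum_comm, sum_eq_single j (fun l _ hl => hoff j l hl.symm) (by simp), hdiag, sq]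

theorem imbalance_flipOthers {a : ι → ℝ} {i : ι} (ha : a i = 0) (b : ι → Bool) :
    imbalance a (flipOthers i b) = -imbalance a b := by
  unfold imbalance
  rw [← sum_neg_distrib]
  refine sum_congr rfl fun j _ => ?_
  by_cases h : j = i
  · subst h
    simp [ha]
  · cases hb : b j <;> simp [flipOthers, h, hb]

end RandomSides

/-! ### Sequences with decreasing increments -/

theorem mul_increment_le {V : ℕ → ℝ} {E : ℕ} (h0 : 0 ≤ V 0)
    (hV : AntitoneOn (fun k => V (k + 1) - V k) (Set.Iio E)) {k : ℕ} (hk : k < E) {y : ℕ}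
    (hy : y ≤ k) : y * (V (k + 1) - V k) ≤ V y := by
  induction y with
  | zero => simpa using h0
  | succ y ih =>
    have h1 := ih (by omega)
    have h2 : V (k + 1) - V k ≤ V (y + 1) - V y :=
      hV (show y < E by omega) hk (by omega)
    push_cast
    linarith

theorem mul_le_mul_of_increments {V : ℕ → ℝ} {E : ℕ} (h0 : 0 ≤ V 0)
    (hV : AntitoneOn (fun k => V (k + 1) - V k) (Set.Iio E)) {y o : ℕ} (hyo : y ≤ o)
    (ho : o ≤ E) : y * V o ≤ o * V y := by
  induction o, hyo using Nat.le_induction with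
  | base => exact le_rfl
  | succ o hyo ih =>
    have h1 := ih (by omega)
    have h2 := mul_increment_le h0 hV (show o < E by omega) hyo
    push_cast
    linarith

/-! ### Units of the good -/

section Units

variable {n : ℕ} (r : Allocation n)

/-- The number of whole units, of size `1 / (100 * n)`, in the endowment of player `i`. Only these
are traded. -/
def units (i : Fin n) : ℕ := ⌊(r.1 i : ℝ) * (100 * n)⌋₊

/-- The number of units on the market. -/
def totalUnits : ℕ := ∑ i, units r i

/-- The amount that player `i` has when she holds `k` units, which includes the part of her
endowment that is not traded. The projection to the unit interval is only there to make the
definition total. -/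
def amount (i : Fin n) (k : ℕ) : unitInterval :=
  Set.projIcc 0 1 zero_le_one (((r.1 i : ℝ) - units r i / (100 * n)) + k / (100 * n))

/-- The value of `k` units for player `i`. -/
def unitValue (v : Valuation) (i : Fin n) (k : ℕ) : ℝ := v (amount r i k)

/-- The value that player `i` attaches to unit number `k + 1`. -/
def marginal (v : Valuation) (i : Fin n) (k : ℕ) : ℝ :=
  unitValue r v i (k + 1) - unitValue r v i k

variable {r}

theorem Allocation.pos (r : Allocation n) : (0 : ℝ) < n := by
  rcases Nat.eq_zero_or_pos n with h | h
  · subst h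
    simpa using r.2
  · exact_mod_cast h

theorem units_le (i : Fin n) : (units r i : ℝ) ≤ r.1 i * (100 * n) :=
  Nat.floor_le (mul_nonneg (r.1 i).2.1 (by positivity))

theorem lt_units_add_one (i : Fin n) : (r.1 i : ℝ) * (100 * n) < units r i + 1 :=
  Nat.lt_floor_add_one _

theorem totalUnits_le : (totalUnits r : ℝ) ≤ 100 * n := by
  unfold totalUnits
  push_cast
  calc ∑ i, (units r i : ℝ) ≤ ∑ i, (r.1 i : ℝ) * (100 * n) := sum_le_sum fun i _ => units_le i
    _ = 100 * n := by rw [← sum_mul, r.2, one_mul]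

theorem le_totalUnits : 99 * (n : ℝ) ≤ totalUnits r := by
  have h : ∑ i, (r.1 i : ℝ) * (100 * n) ≤ ∑ i, ((units r i : ℝ) + 1) :=
    sum_le_sum fun i _ => (lt_units_add_one i).le
  rw [← sum_mul, r.2, sum_add_distrib] at h
  unfold totalUnits
  push_cast
  simp at h
  linarith

theorem units_le_totalUnits (i : Fin n) : units r i ≤ totalUnits r :=
  single_le_sum (fun _ _ => Nat.zero_le _) (mem_univ i)

theorem units_div_le (i : Fin n) : (units r i : ℝ) / (100 * n) ≤ r.1 i := by
  have := r.pos
  rw [div_le_iff₀ (by positivity)]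
  exact units_le i

theorem coe_amount (i : Fin n) {k : ℕ} (hk : k ≤ totalUnits r) :
    (amount r i k : ℝ) = ((r.1 i : ℝ) - units r i / (100 * n)) + k / (100 * n) := by
  have hn := r.pos
  unfold amount
  rw [Set.projIcc_of_mem]
  constructor
  · have := units_div_le (r := r) i
    have : (0 : ℝ) ≤ k / (100 * n) := by positivity
    linarith
  · have h1 : (k : ℝ) / (100 * n) ≤ ∑ j, (units r j : ℝ) / (100 * n) := by
      rw [← sum_div]
      gcongr
      exact_mod_cast hk
    have h2 : ∑ j, ((r.1 j : ℝ) - units r j / (100 * n)) = 1 - ∑ j, (units r j : ℝ) / (100 * n) := by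
      rw [sum_sub_distrib, r.2]
    have h3 : (r.1 i : ℝ) - units r i / (100 * n)
        ≤ ∑ j, ((r.1 j : ℝ) - units r j / (100 * n)) :=
      single_le_sum (f := fun j => (r.1 j : ℝ) - units r j / (100 * n))
        (fun j _ => sub_nonneg.2 (units_div_le j)) (mem_univ i)
    linarith

theorem amount_units (i : Fin n) : amount r i (units r i) = r.1 i := by
  ext
  rw [coe_amount i (units_le_totalUnits i)]
  ring

theorem amount_mono (i : Fin n) : Monotone (amount r i) := by
  intro k l h
  unfold amount
  refine Set.monotone_projIcc _ ?_
  have : (k : ℝ) ≤ l := by exact_mod_cast h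
  gcongr

theorem Valuation.nonneg (v : Valuation) (x : unitInterval) : 0 ≤ v x := by
  rw [← v.normalized]
  exact v.monotone x.2.1

theorem unitValue_nonneg (v : Valuation) (i : Fin n) (k : ℕ) : 0 ≤ unitValue r v i k :=
  v.nonneg _

theorem unitValue_mono (v : Valuation) (i : Fin n) : Monotone (unitValue r v i) :=
  fun _ _ h => v.monotone (amount_mono i h)

theorem marginal_nonneg (v : Valuation) (i : Fin n) (k : ℕ) : 0 ≤ marginal r v i k :=
  sub_nonneg.2 (unitValue_mono v i (Nat.le_succ k))

theorem antitoneOn_marginal (v : Valuation) (i : Fin n) :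
    AntitoneOn (marginal r v i) (Set.Iio (totalUnits r)) := by
  intro k hk l hl hkl
  rw [Set.mem_Iio] at hk hl
  rcases hkl.eq_or_lt with rfl | hlt
  · exact le_rfl
  have hn := r.pos
  have hstep : ∀ j, j < totalUnits r →
      (amount r i j : ℝ) + 1 / (100 * n) = amount r i (j + 1) := by
    intro j hj
    rw [coe_amount i hj.le, coe_amount i hj]
    push_cast
    ring
  have hk' : (amount r i k : ℝ) + 1 / (100 * n) ∈ unitInterval := by
    rw [hstep k hk]
    exact (amount r i (k + 1)).2
  have hl' : (amount r i l : ℝ) + 1 / (100 * n) ∈ unitInterval := by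
    rw [hstep l hl]
    exact (amount r i (l + 1)).2
  have hlt' : amount r i k < amount r i l := by
    rw [← Subtype.coe_lt_coe, coe_amount i hk.le, coe_amount i hl.le]
    have : (k : ℝ) < l := by exact_mod_cast hlt
    gcongr
  have h := v.decreasing_marginals (1 / (100 * n)) _ _ hk' hl' (by positivity) hlt'
  have e1 : (⟨_, hk'⟩ : unitInterval) = amount r i (k + 1) := Subtype.ext (hstep k hk)
  have e2 : (⟨_, hl'⟩ : unitInterval) = amount r i (l + 1) := Subtype.ext (hstep l hl)
  rw [e1, e2] at h
  exact h

/-- Part of an amount is worth at least the same part of its value; the part `1 / 8` suffices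
here. -/
theorem Valuation.div_eight_le (v : Valuation) {x y : unitInterval} (h : (x : ℝ) / 8 ≤ y) :
    v x / 8 ≤ v y := by
  rcases x.2.1.eq_or_lt with hx | hx
  · have : x = 0 := Subtype.ext hx.symm
    rw [this, v.normalized, zero_div]
    exact v.nonneg y
  have hmem : ∀ k : ℕ, k ≤ 8 → (k : ℝ) * (x / 8) ∈ unitInterval := by
    intro k hk
    have h8 : (k : ℝ) ≤ 8 := by exact_mod_cast hk
    refine ⟨by positivity, ?_⟩
    have := x.2.2
    nlinarith
  have key : ∀ k : ℕ, ∀ hk : k ≤ 8,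
      v ⟨_, hmem k hk⟩ ≤ k * v ⟨_, hmem 1 (by norm_num)⟩ := by
    intro k
    induction k with
    | zero =>
      intro hk
      have : (⟨_, hmem 0 hk⟩ : unitInterval) = 0 := Subtype.ext (by simp)
      rw [this, v.normalized]
      simp
    | succ k ih =>
      intro hk
      have ih' := ih (by omega)
      rcases Nat.eq_zero_or_pos k with rfl | hpos
      · simp
      have hk1 : (k : ℝ) * (x / 8) + x / 8 ∈ unitInterval := by
        have := hmem (k + 1) hk
        push_cast at this
        rwa [add_one_mul] at this
      have h01 : ((0 : unitInterval) : ℝ) + x / 8 ∈ unitInterval := by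
        have := hmem 1 (by norm_num)
        simpa using this
      have h := v.decreasing_marginals (x / 8) 0 ⟨_, hmem k (by omega)⟩ h01 hk1 (by positivity)
        (by
          rw [← Subtype.coe_lt_coe]
          show (0 : ℝ) < k * (x / 8)
          positivity)
      have e1 : (⟨_, hk1⟩ : unitInterval) = ⟨_, hmem (k + 1) hk⟩ :=
        Subtype.ext (by push_cast; ring)
      have e2 : (⟨_, h01⟩ : unitInterval) = ⟨_, hmem 1 (by norm_num)⟩ :=
        Subtype.ext (by simp)
      rw [e1, e2, v.normalized] at h
      push_cast at h ih' ⊢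
      linarith
  have h8 := key 8 le_rfl
  have e8 : (⟨_, hmem 8 le_rfl⟩ : unitInterval) = x := Subtype.ext (by push_cast; ring)
  rw [e8] at h8
  have hy : v ⟨_, hmem 1 (by norm_num)⟩ ≤ v y := by
    refine v.monotone ?_
    rw [← Subtype.coe_le_coe]
    simpa using h
  push_cast at h8
  linarith

/-- An eighth of the optimal welfare can be had with `14 * n` units, that is with `14 %` of the
good: rounding `n` amounts up costs at most `n` units. -/
theorem exists_units_welfare (v : Fin n → Valuation) (a : Allocation n) :
    ∃ k : Fin n → ℕ, (∀ i, k i ≤ totalUnits r) ∧ ∑ i, k i ≤ 14 * n ∧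
      welfare v a / 8 ≤ ∑ i, unitValue r (v i) i (k i) := by
  have hn := r.pos
  have hE := le_totalUnits (r := r)
  have hnonneg : ∀ i, (0 : ℝ) ≤ a.1 i / 8 * (100 * n) := fun i =>
    mul_nonneg (div_nonneg (a.1 i).2.1 (by norm_num)) (by positivity)
  have hsum : ∑ i, ⌈(a.1 i : ℝ) / 8 * (100 * n)⌉₊ ≤ 14 * n := by
    have h : ∑ i, (⌈(a.1 i : ℝ) / 8 * (100 * n)⌉₊ : ℝ)
        ≤ ∑ i, ((a.1 i : ℝ) / 8 * (100 * n) + 1) :=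
      sum_le_sum fun i _ => (Nat.ceil_lt_add_one (hnonneg i)).le
    rw [sum_add_distrib, ← sum_mul, ← sum_div, a.2] at h
    simp at h
    have h' : ((∑ i, ⌈(a.1 i : ℝ) / 8 * (100 * n)⌉₊ : ℕ) : ℝ) ≤ ((14 * n : ℕ) : ℝ) := by
      push_cast
      linarith
    exact_mod_cast h'
  have hle : ∀ i, ⌈(a.1 i : ℝ) / 8 * (100 * n)⌉₊ ≤ totalUnits r := by
    intro i
    have h1 : ⌈(a.1 i : ℝ) / 8 * (100 * n)⌉₊ ≤ 14 * n :=
      (single_le_sum (f := fun i => ⌈(a.1 i : ℝ) / 8 * (100 * n)⌉₊)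
        (fun _ _ => Nat.zero_le _) (mem_univ i)).trans hsum
    have h2 : 14 * n ≤ totalUnits r := by
      have : ((14 * n : ℕ) : ℝ) ≤ totalUnits r := by
        push_cast
        linarith
      exact_mod_cast this
    exact h1.trans h2
  refine ⟨_, hle, hsum, ?_⟩
  unfold welfare
  rw [sum_div]
  refine sum_le_sum fun i _ => (v i).div_eight_le ?_
  rw [coe_amount i (hle i)]
  have h1 := Nat.le_ceil ((a.1 i : ℝ) / 8 * (100 * n))
  have h2 := units_div_le (r := r) i
  have h3 : (a.1 i : ℝ) / 8 ≤ ⌈(a.1 i : ℝ) / 8 * (100 * n)⌉₊ / (100 * n) := by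
    rw [le_div_iff₀ (by positivity)]
    exact h1
  linarith

end Units

/-! ### The mechanism for a given partition of the players -/

section TwoSides

variable {n : ℕ} (r : Allocation n) (v : Fin n → Valuation) (b : Fin n → Bool)

/-- The players on the side of `i`. -/
def side (b : Fin n → Bool) (i : Fin n) : Finset (Fin n) := {j | b j = b i}

/-- The players on the other side than `i`. -/
def otherSide (b : Fin n → Bool) (i : Fin n) : Finset (Fin n) := {j | b j ≠ b i}

/-- The price for the players on the side of `i`: the lowest one at which the other side wants at
most `14 * n` units. -/
def sidePrice (i : Fin n) : WithBot (ℝ ×ₗ Fin n) :=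
  price (totalUnits r) (14 * n) (fun j => marginal r (v j) j) (otherSide b i)

/-- The number of units that player `i` wants to hold. -/
def wanted (i : Fin n) : ℕ :=
  demand (totalUnits r) (marginal r (v i) i) i (sidePrice r v b i)

/-- The number of units that player `i` holds after trade within her side. -/
def finalUnits (i : Fin n) : ℕ := holding (wanted r v b) (units r) (side b i) i

variable {r v b}

theorem mem_side_self (i : Fin n) : i ∈ side b i := by simp [side]

theorem notMem_otherSide (i : Fin n) : i ∉ otherSide b i := by simp [otherSide]

theorem otherSide_congr {i j : Fin n} (h : b j = b i) : otherSide b j = otherSide b i := by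
  simp [otherSide, h]

theorem side_congr {i j : Fin n} (h : b j = b i) : side b j = side b i := by
  simp [side, h]

theorem sidePrice_congr {i j : Fin n} (h : b j = b i) : sidePrice r v b j = sidePrice r v b i := by
  unfold sidePrice
  rw [otherSide_congr h]

theorem wanted_le (i : Fin n) : wanted r v b i ≤ totalUnits r := demand_le _ _ _ _

theorem finalUnits_le (i : Fin n) : finalUnits r v b i ≤ totalUnits r :=
  holding_le (wanted_le i) (units_le_totalUnits i)

/-- Trade within each side conserves any quantity that is proportional to the units by a factor
common to the side. -/
theorem sum_mul_finalUnits (x : Fin n → ℝ) (hx : ∀ i j, b j = b i → x j = x i) :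
    ∑ i, x i * finalUnits r v b i = ∑ i, x i * (units r i : ℝ) := by
  rw [← sum_fiberwise univ b, ← sum_fiberwise univ b (fun i => x i * (units r i : ℝ))]
  refine sum_congr rfl fun c _ => ?_
  rcases ({i | b i = c} : Finset (Fin n)).eq_empty_or_nonempty with h | ⟨i₀, h₀⟩
  · simp [h]
  have hc : b i₀ = c := by simpa using h₀
  have hG : ({i | b i = c} : Finset (Fin n)) = side b i₀ := by simp [side, hc]
  rw [hG]
  have hmem : ∀ j ∈ side b i₀, b j = b i₀ := by simp [side]
  have h1 : ∑ j ∈ side b i₀, x j * (finalUnits r v b j : ℝ)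
      = x i₀ * ((∑ j ∈ side b i₀, holding (wanted r v b) (units r) (side b i₀) j : ℕ) : ℝ) := by
    push_cast
    rw [mul_sum]
    refine sum_congr rfl fun j hj => ?_
    rw [hx i₀ j (hmem j hj), finalUnits, side_congr (hmem j hj)]
  rw [h1, sum_holding]
  push_cast
  rw [mul_sum]
  exact sum_congr rfl fun j hj => by rw [hx i₀ j (hmem j hj)]

theorem sum_amount_finalUnits : ∑ i, (amount r i (finalUnits r v b i) : ℝ) = 1 := by
  have h := sum_mul_finalUnits (r := r) (v := v) (b := b) (fun _ => 1) fun _ _ _ => rfl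
  simp only [one_mul] at h
  rw [sum_congr rfl fun i _ => coe_amount i (finalUnits_le i), sum_add_distrib, ← sum_div, h,
    sum_sub_distrib, ← sum_div, r.2]
  ring

variable (r b)

/-- The mechanism that lets each side trade at the price computed from the other side. -/
def twoSidedMechanism : Mechanism n where
  alloc v := ⟨fun i => amount r i (finalUnits r v b i), sum_amount_finalUnits⟩
  pay v i := rate (sidePrice r v b i) * ((finalUnits r v b i : ℝ) - units r i)

variable {r b}

theorem utility_twoSidedMechanism (i : Fin n) (u : Valuation) (v : Fin n → Valuation) :
    (twoSidedMechanism r b).utility i u v = unitValue r u i (finalUnits r v b i)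
      - rate (sidePrice r v b i) * ((finalUnits r v b i : ℝ) - units r i) := rfl

theorem utility_le_succ {i : Fin n} {k : ℕ} (hk : k < wanted r v b i) :
    unitValue r (v i) i k - rate (sidePrice r v b i) * ((k : ℝ) - units r i)
      ≤ unitValue r (v i) i (k + 1)
        - rate (sidePrice r v b i) * (((k + 1 : ℕ) : ℝ) - units r i) := by
  have h := (lt_demand_iff (antitoneOn_marginal (v i) i) (hk.trans_le (wanted_le i))).1 hk
  have h' := rate_le_of_lt_key (marginal_nonneg (v i) i k) h
  unfold marginal at h'
  push_cast
  linarith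

theorem utility_succ_le {i : Fin n} {k : ℕ} (hk : wanted r v b i ≤ k) (hkE : k < totalUnits r) :
    unitValue r (v i) i (k + 1) - rate (sidePrice r v b i) * (((k + 1 : ℕ) : ℝ) - units r i)
      ≤ unitValue r (v i) i k - rate (sidePrice r v b i) * ((k : ℝ) - units r i) := by
  have h := mt (lt_demand_iff (antitoneOn_marginal (v i) i) hkE).2 (not_lt.2 hk)
  have h' := le_rate_of_key_le h
  unfold marginal at h'
  push_cast
  linarith

variable (r b)

theorem truthful_twoSidedMechanism : (twoSidedMechanism r b).Truthful := by
  intro v i w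
  rw [utility_twoSidedMechanism, utility_twoSidedMechanism]
  have hprice : ∀ j, b j = b i →
      sidePrice r (Function.update v i w) b j = sidePrice r v b j := by
    intro j hj
    refine price_congr fun l hl => ?_
    rw [otherSide_congr hj] at hl
    have : l ≠ i := fun h => notMem_otherSide i (h ▸ hl)
    rw [Function.update_of_ne this]
  rw [hprice i rfl]
  refine le_holding_of_singlePeaked
    (U := fun k => unitValue r (v i) i k - rate (sidePrice r v b i) * ((k : ℝ) - units r i))
    (d := wanted r v b) (d' := wanted r (Function.update v i w) b)
    (fun k hk => utility_le_succ hk) (fun k hk hkE => utility_succ_le hk hkE) ?_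
    (units_le_totalUnits i) (wanted_le i) (wanted_le i)
  intro j hj hji
  have hbj : b j = b i := by simpa [side] using hj
  unfold wanted
  rw [hprice j hbj, Function.update_of_ne hji]

theorem individuallyRational_twoSidedMechanism :
    (twoSidedMechanism r b).IndividuallyRational r := by
  intro v i
  rw [utility_twoSidedMechanism]
  have h := le_holding_of_singlePeaked_self
    (U := fun k => unitValue r (v i) i k - rate (sidePrice r v b i) * ((k : ℝ) - units r i))
    (d := wanted r v b) (e := units r) (G := side b i) (i := i)
    (fun k hk => utility_le_succ hk) (fun k hk hkE => utility_succ_le hk hkE)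
    (units_le_totalUnits i) (wanted_le i)
  simp only [sub_self, mul_zero, sub_zero] at h
  rw [unitValue, amount_units] at h
  exact h

theorem weaklyBudgetBalanced_twoSidedMechanism :
    (twoSidedMechanism r b).WeaklyBudgetBalanced := by
  intro v
  have h := sum_mul_finalUnits (r := r) (v := v) (b := b) (fun i => rate (sidePrice r v b i))
    fun i j hij => by rw [sidePrice_congr hij]
  refine le_of_eq ?_
  simp only [twoSidedMechanism, mul_sub, sum_sub_distrib, h, sub_self]

end TwoSides

/-! ### Welfare -/

section Welfare

variable {n : ℕ} {r : Allocation n}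

/-- The tradable endowments of the players other than `i`. -/
def othersUnits (r : Allocation n) (i : Fin n) (j : Fin n) : ℝ := if j = i then 0 else units r j

/-- The units on the side of `i` amount to half of the market, up to the imbalance between the
other players. -/
theorem totalUnits_sub_imbalance_le (b : Fin n → Bool) (i : Fin n) :
    (totalUnits r : ℝ) - |imbalance (othersUnits r i) b|
      ≤ 2 * ((∑ j ∈ side b i, units r j : ℕ) : ℝ) := by
  have h1 : 2 * ((∑ j ∈ side b i, units r j : ℕ) : ℝ) - totalUnits r
      = ∑ j, if b j = b i then (units r j : ℝ) else -units r j := by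
    unfold totalUnits side
    push_cast
    rw [sum_filter, mul_sum, ← sum_sub_distrib]
    refine sum_congr rfl fun j _ => ?_
    split_ifs <;> ring
  have h2 : ∀ j, (if b j = b i then (units r j : ℝ) else -units r j)
      = (if b i then 1 else -1) * (if b j then othersUnits r i j else -othersUnits r i j)
        + (if j = i then (units r i : ℝ) else 0) := by
    intro j
    by_cases h : j = i
    · subst h
      simp [othersUnits]
    · cases hi : b i <;> cases hj : b j <;> simp [othersUnits, h]
  rw [sum_congr rfl fun j _ => h2 j, sum_add_distrib, ← mul_sum] at h1
  simp only [sum_ite_eq', mem_univ, if_true] at h1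
  change _ = (if b i then 1 else -1) * imbalance (othersUnits r i) b + _ at h1
  have h3 : (0 : ℝ) ≤ units r i := by positivity
  have h4 := neg_abs_le (imbalance (othersUnits r i) b)
  have h5 := le_abs_self (imbalance (othersUnits r i) b)
  push_cast at h1 ⊢
  cases hi : b i <;> simp [hi] at h1 <;> linarith

/-- The amount `min o (s - N)`, where `s` is the number of units on a side, is worth a share of the
value of `o` units that depends on the imbalance `x` only. -/
theorem credit_mul_le {V : ℕ → ℝ} {E N o s : ℕ} {x : ℝ} (h0 : 0 ≤ V 0) (hmono : Monotone V)
    (hV : AntitoneOn (fun k => V (k + 1) - V k) (Set.Iio E)) (hN : 0 < N) (hoN : o ≤ N)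
    (hNE : 6 * N ≤ E) (hs : (E : ℝ) - |x| ≤ 2 * s) :
    (1 - x ^ 2 / ((E : ℝ) - 2 * N) ^ 2) * V o ≤ V (min o (s - N)) := by
  have hnonneg : ∀ k, 0 ≤ V k := fun k => h0.trans (hmono (Nat.zero_le k))
  have hNpos : (0 : ℝ) < N := by exact_mod_cast hN
  have hNE' : 6 * (N : ℝ) ≤ E := by exact_mod_cast hNE
  set Z : ℝ := (E : ℝ) - 2 * N with hZ
  have hZpos : 0 < Z := by linarith
  have hcredit : x ^ 2 / Z ^ 2 = (|x| / Z) ^ 2 := by rw [div_pow, sq_abs]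
  have hle1 : 1 - x ^ 2 / Z ^ 2 ≤ 1 := by
    have : 0 ≤ x ^ 2 / Z ^ 2 := by positivity
    linarith
  rcases le_total o (s - N) with h | h
  · rw [min_eq_left h]
    exact mul_le_of_le_one_left (hnonneg o) hle1
  rw [min_eq_right h]
  rcases lt_or_ge Z |x| with hx | hx
  · have h1 : 1 ≤ |x| / Z := by
      rw [le_div_iff₀ hZpos]
      linarith
    have h2 : 1 - x ^ 2 / Z ^ 2 ≤ 0 := by
      rw [hcredit]
      nlinarith
    exact (mul_nonpos_of_nonpos_of_nonneg h2 (hnonneg o)).trans (hnonneg _)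
  -- The quadratic credit lies below the linear one because `Z ≥ 4 * N`.
  have hy : Z - |x| ≤ 2 * ((s - N : ℕ) : ℝ) := by
    have : (s : ℝ) ≤ ((s - N : ℕ) : ℝ) + N := by exact_mod_cast (by omega : s ≤ s - N + N)
    linarith
  have h1 : (1 - x ^ 2 / Z ^ 2) * N ≤ ((s - N : ℕ) : ℝ) := by
    have h2 : (1 - x ^ 2 / Z ^ 2) * N = (Z - |x|) * ((Z + |x|) * N) / Z ^ 2 := by
      rw [hcredit]
      field_simp
      ring
    rw [h2, div_le_iff₀ (by positivity)]
    have h3 : (Z + |x|) * N ≤ Z ^ 2 / 2 := by nlinarith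
    have h4 : (Z - |x|) * ((Z + |x|) * N) ≤ (Z - |x|) * (Z ^ 2 / 2) :=
      mul_le_mul_of_nonneg_left h3 (by linarith)
    nlinarith [sq_nonneg Z]
  have h5 := mul_le_mul_of_increments h0 hV h (by omega : o ≤ E)
  have h6 : (o : ℝ) ≤ N := by exact_mod_cast hoN
  have h7 : (1 - x ^ 2 / Z ^ 2) * V o * N ≤ V (s - N) * N := by
    calc (1 - x ^ 2 / Z ^ 2) * V o * N = (1 - x ^ 2 / Z ^ 2) * N * V o := by ring
      _ ≤ ((s - N : ℕ) : ℝ) * V o := mul_le_mul_of_nonneg_right h1 (hnonneg o)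
      _ ≤ o * V (s - N) := h5
      _ ≤ N * V (s - N) := mul_le_mul_of_nonneg_right h6 (hnonneg _)
      _ = V (s - N) * N := mul_comm _ _
  exact le_of_mul_le_mul_right h7 hNpos

theorem six_mul_le_totalUnits : 6 * (14 * n) ≤ totalUnits r := by
  have h := le_totalUnits (r := r)
  have hn := r.pos
  have : ((6 * (14 * n) : ℕ) : ℝ) ≤ totalUnits r := by
    push_cast
    linarith
  exact_mod_cast this

/-- The case in which the rest of the side of `i` wants at most `14 * n` units. -/
theorem credit_mul_le_of_totalDemand {v : Fin n → Valuation} {b : Fin n → Bool} {i : Fin n} {o : ℕ}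
    (hoN : o ≤ 14 * n) (ho : o ≤ wanted r v b i)
    (h : totalDemand (totalUnits r) (fun j => marginal r (v j) j) ((side b i).erase i)
      (sidePrice r v b i) ≤ 14 * n) :
    (1 - imbalance (othersUnits r i) b ^ 2 / ((totalUnits r : ℝ) - 2 * (14 * n : ℕ)) ^ 2)
        * unitValue r (v i) i o
      ≤ unitValue r (v i) i (finalUnits r v b i) := by
  have hn : 0 < n := by exact_mod_cast r.pos
  refine (credit_mul_le (unitValue_nonneg _ _ _) (unitValue_mono _ _) (antitoneOn_marginal (v i) i)
    (by omega) hoN six_mul_le_totalUnits (totalUnits_sub_imbalance_le b i)).trans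
    (unitValue_mono _ _ ?_)
  refine le_trans (min_le_min_right _ ho) (min_le_holding (mem_side_self i) ?_)
  refine le_trans (le_of_eq (sum_congr rfl fun j hj => ?_)) h
  have hbj : b j = b i := by simpa [side] using mem_of_mem_erase hj
  rw [wanted, sidePrice_congr hbj]

theorem otherSide_flipOthers (b : Fin n → Bool) (i : Fin n) :
    otherSide (flipOthers i b) i = (side b i).erase i := by
  ext j
  by_cases h : j = i
  · simp [otherSide, h]
  · simp [otherSide, side, flipOthers, h]

theorem side_flipOthers_erase (b : Fin n → Bool) (i : Fin n) :
    (side (flipOthers i b) i).erase i = otherSide b i := by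
  ext j
  by_cases h : j = i
  · simp [otherSide, h]
  · cases hj : b j <;> cases hi : b i <;> simp [otherSide, side, flipOthers, h, hj, hi]

/-- Of the two ways to add player `i` to one side of a partition of the others, at least one is
good for her: the side with the lower price does not want more than `14 * n` units at the price of
the other one. -/
theorem credit_mul_le_add_flipOthers {v : Fin n → Valuation} (b : Fin n → Bool) {i : Fin n} {o : ℕ}
    (hoN : o ≤ 14 * n) (ho : ∀ b, o ≤ wanted r v b i) :
    (1 - imbalance (othersUnits r i) b ^ 2 / ((totalUnits r : ℝ) - 2 * (14 * n : ℕ)) ^ 2)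
        * unitValue r (v i) i o
      ≤ unitValue r (v i) i (finalUnits r v b i)
        + unitValue r (v i) i (finalUnits r v (flipOthers i b) i) := by
  have hprice : sidePrice r v (flipOthers i b) i = price (totalUnits r) (14 * n)
      (fun j => marginal r (v j) j) ((side b i).erase i) := by
    rw [sidePrice, otherSide_flipOthers]
  rcases le_total (price (totalUnits r) (14 * n) (fun j => marginal r (v j) j)
    ((side b i).erase i)) (sidePrice r v b i) with h | h
  · have h1 := credit_mul_le_of_totalDemand hoN (ho b)
      ((totalDemand_antitone _ _ _ h).trans (totalDemand_price_le _ _ _ _))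
    have h2 := unitValue_nonneg (r := r) (v i) i (finalUnits r v (flipOthers i b) i)
    linarith
  · have h1 := credit_mul_le_of_totalDemand hoN (ho (flipOthers i b)) (by
      rw [side_flipOthers_erase, hprice]
      exact (totalDemand_antitone _ _ _ h).trans (totalDemand_price_le _ _ _ _))
    rw [imbalance_flipOthers (by simp [othersUnits]), neg_sq] at h1
    have h2 := unitValue_nonneg (r := r) (v i) i (finalUnits r v b i)
    linarith

theorem sum_othersUnits_sq_le (hr : ∀ i, (r.1 i : ℝ) ≤ 1 / 3) (i : Fin n) :
    ∑ j, othersUnits r i j ^ 2 ≤ (100 * (n : ℝ)) ^ 2 / 3 := by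
  have hn := r.pos
  have h : ∀ j, othersUnits r i j ^ 2 ≤ 100 * n / 3 * units r j := by
    intro j
    have h0 : (0 : ℝ) ≤ units r j := by positivity
    unfold othersUnits
    split_ifs
    · rw [zero_pow two_ne_zero]
      positivity
    · have h1 : (units r j : ℝ) ≤ 100 * n / 3 := by
        have := units_le (r := r) j
        have := hr j
        nlinarith
      nlinarith
  refine (sum_le_sum fun j _ => h j).trans ?_
  have h2 := totalUnits_le (r := r)
  unfold totalUnits at h2
  push_cast at h2
  rw [← mul_sum]
  nlinarith

/-- On average over the partitions, player `i` gets a sixth of the value of any number of units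
which she wants at every price and which is not too large. -/
theorem sixth_le_average (hr : ∀ i, (r.1 i : ℝ) ≤ 1 / 3) {v : Fin n → Valuation} {i : Fin n} {o : ℕ}
    (hoN : o ≤ 14 * n) (ho : ∀ b, o ≤ wanted r v b i) :
    2 ^ n * (unitValue r (v i) i o / 6)
      ≤ ∑ b : Fin n → Bool, unitValue r (v i) i (finalUnits r v b i) := by
  have hn := r.pos
  set Z : ℝ := (totalUnits r : ℝ) - 2 * (14 * n : ℕ) with hZ
  have hZn : 71 * (n : ℝ) ≤ Z := by
    have := le_totalUnits (r := r)
    rw [hZ]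
    push_cast
    linarith
  have hsum := sum_le_sum fun b (_ : b ∈ (univ : Finset (Fin n → Bool))) =>
    credit_mul_le_add_flipOthers b hoN ho
  have hflip : ∑ b : Fin n → Bool, unitValue r (v i) i (finalUnits r v (flipOthers i b) i)
      = ∑ b : Fin n → Bool, unitValue r (v i) i (finalUnits r v b i) :=
    Equiv.sum_comp ((flipOthers_involutive i).toPerm _)
      fun b => unitValue r (v i) i (finalUnits r v b i)
  rw [sum_add_distrib, hflip, ← sum_mul, sum_sub_distrib, ← sum_div, sum_imbalance_sq] at hsum
  simp only [sum_const, card_univ, Fintype.card_pi, Fintype.card_bool, prod_const, Fintype.card_fin,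
    nsmul_eq_mul, mul_one] at hsum
  push_cast at hsum
  -- `100 ^ 2 / 3 ≤ 2 / 3 * 71 ^ 2`
  have hq : (∑ j, othersUnits r i j ^ 2) / Z ^ 2 ≤ 2 / 3 := by
    rw [div_le_iff₀ (by nlinarith)]
    have := sum_othersUnits_sq_le hr i
    nlinarith
  have hV := unitValue_nonneg (r := r) (v i) i o
  have h2 : (0 : ℝ) < 2 ^ n := by positivity
  have h3 : 2 ^ n * (unitValue r (v i) i o / 3)
      ≤ (2 ^ n - 2 ^ n * (∑ j, othersUnits r i j ^ 2) / Z ^ 2) * unitValue r (v i) i o := by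
    rw [mul_div_assoc]
    have := mul_le_mul_of_nonneg_left hq (mul_nonneg h2.le hV)
    nlinarith
  rw [hZ] at h3
  push_cast at h3
  linarith

variable (r)

/-- Each player is put on one of two sides by a fair coin, and each side trades at the price
computed from the other side. -/
def randomMechanism : RandomizedMechanism n where
  Coins := Fin n → Bool
  law := (PMF.uniformOfFintype (Fin n → Bool)).toMeasure
  isProbabilityMeasure := PMF.toMeasure.isProbabilityMeasure _
  run := twoSidedMechanism r
  measurable_alloc _ _ := measurable_of_finite _
  measurable_pay _ _ := measurable_of_finite _

theorem expectedWelfare_randomMechanism (v : Fin n → Valuation) :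
    (randomMechanism r).expectedWelfare v
      = (∑ b : Fin n → Bool, ∑ i, unitValue r (v i) i (finalUnits r v b i)) / 2 ^ n := by
  unfold RandomizedMechanism.expectedWelfare
  change ∫ b : Fin n → Bool, ∑ i, unitValue r (v i) i (finalUnits r v b i)
    ∂(PMF.uniformOfFintype (Fin n → Bool)).toMeasure = _
  rw [PMF.integral_eq_sum, sum_div]
  refine sum_congr rfl fun b _ => ?_
  simp [PMF.uniformOfFintype_apply, div_eq_inv_mul]

theorem approximates_randomMechanism (hr : ∀ i, (r.1 i : ℝ) ≤ 1 / 3) :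
    (randomMechanism r).Approximates 48 := by
  intro v
  rw [expectedWelfare_randomMechanism, le_div_iff₀ (by positivity), sum_comm]
  obtain ⟨o, hoN, homax, howant⟩ := exists_optimal_units (totalUnits r) (14 * n)
    (fun i => unitValue r (v i) i) fun i => antitoneOn_marginal (v i) i
  have hopt : optWelfare v ≤ 8 * ∑ i, unitValue r (v i) i (o i) := by
    have : Nonempty (Allocation n) := ⟨r⟩
    refine ciSup_le fun a => ?_
    obtain ⟨k, hkE, hkN, hk⟩ := exists_units_welfare (r := r) v a
    linarith [homax k hkE hkN]
  have hplayer : ∀ i, 2 ^ n * (unitValue r (v i) i (o i) / 6)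
      ≤ ∑ b : Fin n → Bool, unitValue r (v i) i (finalUnits r v b i) := fun i =>
    sixth_le_average hr ((single_le_sum (fun _ _ => Nat.zero_le _) (mem_univ i)).trans hoN)
      fun b => howant i _ (notMem_otherSide i)
  have hsum := sum_le_sum fun i (_ : i ∈ (univ : Finset (Fin n))) => hplayer i
  rw [← mul_sum, ← sum_div] at hsum
  refine le_trans ?_ hsum
  rw [mul_comm]
  have : (0 : ℝ) < 2 ^ n := by positivity
  exact mul_le_mul_of_nonneg_left (by linarith) this.le

end Welfare

end ArrowDebreu

end

theorem theorem5p1 (n : ℕ) (r : ArrowDebreu.Allocation n)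
    (hr : ∀ i, (r.1 i : ℝ) ≤ 1 / 3) :
    ∃ M : ArrowDebreu.RandomizedMechanism n,
      M.Truthful ∧ M.IndividuallyRational r ∧ M.WeaklyBudgetBalanced ∧ M.Approximates 48 :=
  ⟨ArrowDebreu.randomMechanism r, ArrowDebreu.truthful_twoSidedMechanism r,
    ArrowDebreu.individuallyRational_twoSidedMechanism r,
    ArrowDebreu.weaklyBudgetBalanced_twoSidedMechanism r,
    ArrowDebreu.approximates_randomMechanism r hr⟩
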